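/- Let $\omega=\exp(i\pi/30)$, let $c_n=\omega^n+\omega^{-n}=2\cos(n\pi/30)$, and let $\tau=\tfrac12(1+\sqrt5)$. The polynomial $45x^8-90x^6+60x^4-15x^2+1$ has exactly four positive real roots $a>b>c>d$, and they satisfy $$2a^2=1+3^{-1/2}5^{-1/4}\tau^{3/2},\quad 2b^2=1+3^{-1/2}5^{-1/4}\tau^{-3/2},\quad 2c^2=1-3^{-1/2}5^{-1/4}\tau^{-3/2},\quad 2d^2=1-3^{-1/2}5^{-1/4}\tau^{3/2}.$$ Set $$r_1=a/c_9,\ r_2=b/c_9,\ r_3=c/c_9,\ r_4=d/c_9,\quad r_5=a/c_3,\ r_6=b/c_3,\ r_7=c/c_3,\ r_8=d/c_3 .$$ For $n\in\{0,1,\dots,29\}$ let $A_n,B_n,\dots,H_n\in\mathbb C^4$ be the rows, in this order, of the $8\times4$ matrix $$\begin{bmatrix} r_1 & r_4 & r_6\omega & r_7\omega \\ r_2\omega^{29} & r_3\omega^{19} & -r_8\omega^{24} & -r_5\omega^{18} \\ r_3\omega^{29} & -r_2\omega^{19} & r_5\omega^{24} & -r_8\omega^{18} \\ r_4 & -r_1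 & r_7\omega & -r_6\omega \\ r_5 & r_8 & -r_2\omega & -r_3\omega \\ r_6\omega^{29} & r_7\omega^{19} & r_4\omega^{24} & r_1\omega^{18} \\ r_7\omega^{29} & -r_6\omega^{19} & -r_1\omega^{24} & r_4\omega^{18} \\ r_8 & -r_5 & -r_3\omega & r_2\omega \end{bmatrix}\cdot\operatorname{diag}(\omega^{2n},\omega^{22n},\omega^{14n},\omega^{26n}).$$ Regard $\mathbb C^4\cong\mathbb R^8$ as a Euclidean space with inner product $\langle u,v\rangle=\operatorname{Re}\sum_j u_j\overline{v_j}$. Then the vectors $A_n,\dots,H_n$ ($n=0,\dots,29$) are 240 distinct vectors, each of norm $1$. They form a (reduced, crystallographic) root system in $\mathbb R^8$ isomorphic to the $E_8$ root system, that is, to the set of vectors of squared length $2$ in the lattice of those $x\in\mathbb R^8$ whose coordinates are all integers or all half-odd integers and have even sum. Moreover, for each fixed $n\in\{0,\dots,29\}$, $\{A_n,B_n,C_n,D_n,E_n,F_n,G_n,H_n\}$ is a system of simple roots, and its Dynkin diagram is the $E_8$ diagram with edges (all simple) $F_nA_n$, $A_nC_n$, $C_nD_n$, $A_nB_n$, $B_nE_n$,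 $E_nG_n$, $G_nH_n$. -/

import Mathlib

noncomputable section

open Polynomial

/-! ### Euclidean root systems as root pairings -/

namespace EuclideanRoots

variable {E : Type*} [NormedAddCommGroup E] [InnerProductSpace ℝ E]

/-- The reflection of `y` in the hyperplane orthogonal to `x`. -/
def refl (x y : E) : E := y - (2 * inner ℝ y x / inner ℝ x x) • x

/-- The coroot `2x / ⟨x, x⟩` of a vector `x`. -/
def coroot (x : E) : E := (2 / inner ℝ x x : ℝ) • x

lemma inner_self_ne {x : E} (hx : x ≠ 0) : (inner ℝ x x : ℝ) ≠ 0 := by simpa using hx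

lemma inner_refl_self {x : E} (hx : x ≠ 0) (y : E) : inner ℝ (refl x y) x = -inner ℝ y x := by
  have := inner_self_ne hx
  simp only [refl, inner_sub_left, real_inner_smul_left]
  field_simp
  ring

lemma refl_refl {x : E} (hx : x ≠ 0) (y : E) : refl x (refl x y) = y := by
  have h : refl x (refl x y)
      = refl x y - (2 * inner ℝ (refl x y) x / inner ℝ x x) • x := rfl
  rw [h, inner_refl_self hx, refl]
  simp only [mul_neg, neg_div, neg_smul]
  abel

lemma inner_refl_refl {x : E} (hx : x ≠ 0) (y : E) :
    (inner ℝ (refl x y) (refl x y) : ℝ) = inner ℝ y y := by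
  have := inner_self_ne hx
  simp only [refl, inner_sub_left, inner_sub_right, real_inner_smul_left, real_inner_smul_right,
    real_inner_comm y x]
  field_simp
  ring

lemma coroot_injective : Function.Injective (coroot : E → E) := by
  intro x y h
  have key : ∀ z : E, coroot (coroot z) = z := by
    intro z
    rcases eq_or_ne z 0 with rfl | hz
    · simp [coroot]
    · have := inner_self_ne hz
      simp only [coroot, real_inner_smul_left, real_inner_smul_right, smul_smul]
      have h1 : (2 / (2 / inner ℝ z z * (2 / inner ℝ z z * inner ℝ z z)) * (2 / inner ℝ z z) : ℝ)
          = 1 := by field_simp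
      rw [h1, one_smul]
  rw [← key x, h, key y]

lemma coroot_refl {x : E} (hx : x ≠ 0) (y : E) :
    coroot y - (inner ℝ x (coroot y) : ℝ) • coroot x = coroot (refl x y) := by
  simp only [coroot, inner_refl_refl hx]
  simp only [refl, real_inner_smul_right, smul_sub, smul_smul, real_inner_comm x y]
  congr 2
  ring

instance instIsPerfPairInner [FiniteDimensional ℝ E] : (innerₗ E).IsPerfPair := by
  have h : Function.Injective (innerₗ E) := by
    intro x y hxy
    exact ext_inner_right ℝ fun v => by simpa using LinearMap.congr_fun hxy v
  refine .of_injective h ?_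
  rwa [show (innerₗ E).flip = innerₗ E from by ext x y; simp]

/-- A set `Φ` of nonzero vectors of a Euclidean space which is stable under the orthogonal
reflections in its members, as a root pairing: the roots are the members of `Φ`, the coroot of `x`
is `2x / ⟨x, x⟩`, and the pairing is the inner product, so that
`pairing x y = 2 ⟨x, y⟩ / ⟨y, y⟩`. -/
def rootPairing [FiniteDimensional ℝ E] (Φ : Set E) (h0 : (0 : E) ∉ Φ)
    (hΦ : ∀ x ∈ Φ, ∀ y ∈ Φ, refl x y ∈ Φ) : RootPairing Φ ℝ E E where
  toLinearMap := innerₗ E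
  root := ⟨fun x => x, Subtype.val_injective⟩
  coroot := ⟨fun x => coroot x, fun _ _ h => Subtype.ext (coroot_injective h)⟩
  root_coroot_two x := by
    have := inner_self_ne (ne_of_mem_of_not_mem x.2 h0)
    simp only [Function.Embedding.coeFn_mk, innerₗ_apply_apply, coroot, real_inner_smul_right]
    field_simp
  reflectionPerm x :=
    { toFun := fun y => ⟨refl x y, hΦ x x.2 y y.2⟩
      invFun := fun y => ⟨refl x y, hΦ x x.2 y y.2⟩
      left_inv := fun y => Subtype.ext (refl_refl (ne_of_mem_of_not_mem x.2 h0) _)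
      right_inv := fun y => Subtype.ext (refl_refl (ne_of_mem_of_not_mem x.2 h0) _) }
  reflectionPerm_root x y := by
    simp only [Function.Embedding.coeFn_mk, innerₗ_apply_apply, coroot, real_inner_smul_right,
      Equiv.coe_fn_mk, refl]
    congr 2
    ring
  reflectionPerm_coroot x y := by
    exact coroot_refl (ne_of_mem_of_not_mem x.2 h0) _

end EuclideanRoots

/-! ### The standard `E₈` root system -/

namespace StandardE8

/-- The `E₈` lattice in `ℝ⁸`: the vectors whose coordinates are either all integers or all
half-odd integers, and whose coordinate sum is an even integer. -/
def lattice : AddSubgroup (EuclideanSpace ℝ (Fin 8)) where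
  carrier := {x | ((∃ m : Fin 8 → ℤ, ∀ i, x i = m i) ∨ (∃ m : Fin 8 → ℤ, ∀ i, x i = m i + 1 / 2)) ∧
    ∃ s : ℤ, ∑ i, x i = 2 * s}
  zero_mem' := ⟨Or.inl ⟨0, by simp⟩, 0, by simp⟩
  add_mem' := by
    rintro x y ⟨hx, s, hs⟩ ⟨hy, t, ht⟩
    refine ⟨?_, s + t, ?_⟩
    · rcases hx with ⟨m, hm⟩ | ⟨m, hm⟩ <;> rcases hy with ⟨k, hk⟩ | ⟨k, hk⟩
      · exact Or.inl ⟨m + k, fun i => by simp [hm, hk]⟩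
      · exact Or.inr ⟨m + k, fun i => by simp [hm, hk]; ring⟩
      · exact Or.inr ⟨m + k, fun i => by simp [hm, hk]; ring⟩
      · exact Or.inl ⟨m + k + 1, fun i => by simp [hm, hk]; ring⟩
    · simp only [PiLp.add_apply, Finset.sum_add_distrib, hs, ht]
      push_cast
      ring
  neg_mem' := by
    rintro x ⟨hx, s, hs⟩
    refine ⟨?_, -s, ?_⟩
    · rcases hx with ⟨m, hm⟩ | ⟨m, hm⟩
      · exact Or.inl ⟨-m, fun i => by simp [hm]⟩
      · exact Or.inr ⟨-m - 1, fun i => by simp [hm]; ring⟩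
    · simp [hs]

lemma inner_eq (x y : EuclideanSpace ℝ (Fin 8)) : (inner ℝ x y : ℝ) = ∑ i, x i * y i := by
  simp [PiLp.inner_apply, mul_comm]

lemma inner_int {x y : EuclideanSpace ℝ (Fin 8)} (hx : x ∈ lattice) (hy : y ∈ lattice) :
    ∃ z : ℤ, (inner ℝ x y : ℝ) = z := by
  obtain ⟨hx, s, hs⟩ := hx
  obtain ⟨hy, t, ht⟩ := hy
  rw [inner_eq]
  rcases hx with ⟨m, hm⟩ | ⟨m, hm⟩ <;> rcases hy with ⟨k, hk⟩ | ⟨k, hk⟩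
  · exact ⟨∑ i, m i * k i, by simp [hm, hk]⟩
  · refine ⟨∑ i, m i * k i + s, ?_⟩
    simp only [hm, hk] at hs ⊢
    simp only [mul_add, Finset.sum_add_distrib, ← Finset.sum_mul, hs]
    push_cast
    ring
  · refine ⟨∑ i, m i * k i + t, ?_⟩
    simp only [hm, hk] at ht ⊢
    simp only [add_mul, Finset.sum_add_distrib, ← Finset.mul_sum, ht]
    push_cast
    ring
  · refine ⟨∑ i, m i * k i + s + t - 2, ?_⟩
    simp only [hm, hk] at hs ht ⊢
    simp only [Finset.sum_add_distrib, Finset.sum_const, Finset.card_univ, Fintype.card_fin] at hs ht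
    simp only [add_mul, mul_add, Finset.sum_add_distrib, ← Finset.mul_sum, ← Finset.sum_mul,
      Finset.sum_const, Finset.card_univ, Fintype.card_fin]
    push_cast
    norm_num at hs ht ⊢
    linarith

/-- The standard `E₈` roots: the vectors of squared length `2` of the `E₈` lattice. -/
def roots : Set (EuclideanSpace ℝ (Fin 8)) := {x | x ∈ lattice ∧ inner ℝ x x = (2 : ℝ)}

lemma zero_notMem_roots : (0 : EuclideanSpace ℝ (Fin 8)) ∉ roots := by
  rintro ⟨-, h⟩
  simp at h

lemma refl_mem_roots : ∀ x ∈ roots, ∀ y ∈ roots, EuclideanRoots.refl x y ∈ roots := by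
  intro x hx y hy
  refine ⟨?_, ?_⟩
  · obtain ⟨z, hz⟩ := inner_int hy.1 hx.1
    rw [EuclideanRoots.refl, hx.2, hz, mul_div_cancel_left₀ _ two_ne_zero, Int.cast_smul_eq_zsmul]
    exact sub_mem hy.1 (zsmul_mem hx.1 z)
  · rw [EuclideanRoots.inner_refl_refl (ne_of_mem_of_not_mem hx zero_notMem_roots), hy.2]

/-- The standard `E₈` root system. -/
def rootPairing :
    RootPairing roots ℝ (EuclideanSpace ℝ (Fin 8)) (EuclideanSpace ℝ (Fin 8)) :=
  EuclideanRoots.rootPairing roots zero_notMem_roots refl_mem_roots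

end StandardE8

/-! ### Triacontagonal coordinates -/

namespace Triacontagonal

/-- `45x⁸ - 90x⁶ + 60x⁴ - 15x² + 1`. -/
def poly : ℝ[X] := 45 * X ^ 8 - 90 * X ^ 6 + 60 * X ^ 4 - 15 * X ^ 2 + 1

/-- `a > b > c > d` are the positive roots of the polynomial. -/
def ArePositiveRoots (a b c d : ℝ) : Prop :=
  a > b ∧ b > c ∧ c > d ∧ {x : ℝ | 0 < x ∧ poly.IsRoot x} = {a, b, c, d}

/-- `ω = exp(iπ/30)`. -/
def ω : ℂ := Complex.exp (Complex.I * Real.pi / 30)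

/-- `cₙ = 2 cos(nπ/30)`. -/
def cosAmp (n : ℕ) : ℝ := 2 * Real.cos (n * Real.pi / 30)

/-- The amplitudes `r₁, …, r₈`, indexed from `0`. -/
def amp (a b c d : ℝ) : Fin 8 → ℝ :=
  ![a / cosAmp 9, b / cosAmp 9, c / cosAmp 9, d / cosAmp 9,
    a / cosAmp 3, b / cosAmp 3, c / cosAmp 3, d / cosAmp 3]

/-- The `8 × 4` matrix of amplitudes and phases, written in terms of `r₁, …, r₈`. -/
def phaseMatrix (r₁ r₂ r₃ r₄ r₅ r₆ r₇ r₈ : ℂ) : Matrix (Fin 8) (Fin 4) ℂ :=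
  !![r₁,            r₄,             r₆ * ω,         r₇ * ω;
     r₂ * ω ^ 29,   r₃ * ω ^ 19,   -r₈ * ω ^ 24,   -r₅ * ω ^ 18;
     r₃ * ω ^ 29,  -r₂ * ω ^ 19,    r₅ * ω ^ 24,   -r₈ * ω ^ 18;
     r₄,           -r₁,             r₇ * ω,        -r₆ * ω;
     r₅,            r₈,            -r₂ * ω,        -r₃ * ω;
     r₆ * ω ^ 29,   r₇ * ω ^ 19,    r₄ * ω ^ 24,    r₁ * ω ^ 18;
     r₇ * ω ^ 29,  -r₆ * ω ^ 19,   -r₁ * ω ^ 24,    r₄ * ω ^ 18;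
     r₈,           -r₅,            -r₃ * ω,         r₂ * ω]

/-- `vec a b c d n k` for `k = 0, …, 7` is the vector `Aₙ, Bₙ, Cₙ, Dₙ, Eₙ, Fₙ, Gₙ, Hₙ` of `ℂ⁴`:
the row `k` of the phase matrix times `diag(ω²ⁿ, ω²²ⁿ, ω¹⁴ⁿ, ω²⁶ⁿ)`. -/
def vec (a b c d : ℝ) (n : Fin 30) (k : Fin 8) : EuclideanSpace ℂ (Fin 4) :=
  let r := amp a b c d
  WithLp.toLp 2 ((phaseMatrix (r 0) (r 1) (r 2) (r 3) (r 4) (r 5) (r 6) (r 7) *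
    Matrix.diagonal ![ω ^ (2 * n.val), ω ^ (22 * n.val), ω ^ (14 * n.val), ω ^ (26 * n.val)]) k)

/-- The set of all the vectors `Aₙ, …, Hₙ` with `n = 0, …, 29`. -/
def vecs (a b c d : ℝ) : Set (EuclideanSpace ℂ (Fin 4)) :=
  {v | ∃ (n : Fin 30) (k : Fin 8), v = vec a b c d n k}

/-- The root pairing whose roots are the vectors `Aₙ, …, Hₙ`, once these are known to be nonzero and
stable under the reflections in each other. -/
def rootPairing (a b c d : ℝ) (h0 : 0 ∉ vecs a b c d)
    (hrefl : ∀ x ∈ vecs a b c d, ∀ y ∈ vecs a b c d, EuclideanRoots.refl x y ∈ vecs a b c d) :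
    RootPairing (vecs a b c d) ℝ (EuclideanSpace ℂ (Fin 4)) (EuclideanSpace ℂ (Fin 4)) :=
  EuclideanRoots.rootPairing (vecs a b c d) h0 hrefl

/-- The position of the letter number `k` (`A = 0, …, H = 7`) in the Dynkin diagram
```
        F
        |
D - C - A - B - E - G - H
```
when the nodes of the diagram of type `E₈` are numbered in the order `D, F, C, A, B, E, G, H`, the
numbering (from `0`) that is used by `CartanMatrix.E₈`. -/
def dynkinPos : Fin 8 → Fin 8 := ![3, 4, 2, 0, 5, 1, 6, 7]

end Triacontagonal

end

/-! ### Arithmetic in `ℤ[ω]` -/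

namespace Zomega

open Triacontagonal

/-! The 240 vectors are the `E₈` roots seen in an eigenbasis of a Coxeter element. The map `rot` =
diag(ω², ω²², ω¹⁴, ω²⁶) has order 30, and its four eigenvalues with their conjugates are the eight
primitive 30th roots of unity.

Two finite computations carry the theorem. By `phase_gram`, the Gram matrix of A₀, …, H₀ is half the
`E₈` Cartan matrix. By `phase_coxeter`, `rot` acts on A₀, …, H₀ through an integer matrix. So the
linear map taking the standard simple roots to A₀, …, H₀ halves inner products, and each Aₙ, …, Hₙ
is the image of a lattice vector of squared length 2, that is, of a root. Conversely, listing the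
standard roots shows that each of them is reached (`doubledRoots_subset`). Reflection stability,
integrality and the isomorphism type then transfer along this similarity (`exists_similarity`). The
base property for n = 0 says that all 240 integer coordinate vectors have entries of one sign
(`orbit_nonneg_or_nonpos`); powers of `rot` carry it to every n.

Both computations are made exact by leaving the radicals behind: the ratios rₖ/r₅ and the number
r₅⁻² lie in ℤ[ω] (`ArePositiveRoots.ratios`), so only identities between integer polynomials in ω
remain. -/

/-- The value at `ω` of the polynomial with the given coefficients. -/
noncomputable def ev (l : List ℤ) : ℂ := l.foldr (fun a s => a + ω * s) 0

/-- Addition of coefficient lists. -/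
def add : List ℤ → List ℤ → List ℤ
  | [], q => q
  | p, [] => p
  | a :: p, b :: q => (a + b) :: add p q

/-- Multiplication by an integer. -/
def smul (a : ℤ) (l : List ℤ) : List ℤ := l.map (a * ·)

/-- Multiplication by the variable, modulo the 60th cyclotomic polynomial. -/
def mulX : List ℤ → List ℤ
  | [a, b, c, d, e, f, g, h, i, j, k, l, m, n, o, p] =>
    [-p, a, b - p, c, d, e, f + p, g, h + p, i, j + p, k, l, m, n - p, o]
  | l => 0 :: l

/-- Multiplication modulo the 60th cyclotomic polynomial. -/
def mul (p q : List ℤ) : List ℤ := p.foldr (fun a s => add (smul a q) (mulX s)) []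

/-- Multiplication by a power of the variable. -/
def shift (n : ℕ) (p : List ℤ) : List ℤ := mulX^[n] p

/-- The powers of the variable. -/
def pow (n : ℕ) : List ℤ := shift n [1]

/-- Division by the variable, modulo the 60th cyclotomic polynomial. -/
def divX : List ℤ → List ℤ
  | [a, b, c, d, e, f, g, h, i, j, k, l, m, n, o, p] =>
    [b, c - a, d, e, f, g + a, h, i + a, j, k + a, l, m, n, o - a, p, -a]
  | l => mul (pow 59) l

/-- The polynomial representing the complex conjugate. -/
def conj (p : List ℤ) : List ℤ := p.foldr (fun a s => add [a] (divX s)) []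

/-- All coefficients of the difference vanish. -/
def same (p q : List ℤ) : Bool := (add p (smul (-1) q)).all (· == 0)

lemma ω_pow (n : ℕ) : ω ^ n = Complex.exp ((n * Real.pi / 30 : ℝ) * Complex.I) := by
  rw [ω, ← Complex.exp_nat_mul]
  congr 1
  push_cast
  ring

lemma ω_pow_30 : ω ^ 30 = -1 := by
  rw [ω_pow, ← Complex.exp_pi_mul_I]
  congr 3
  push_cast
  ring

lemma ω_pow_60 : ω ^ 60 = 1 := by
  rw [show 60 = 30 * 2 from rfl, pow_mul, ω_pow_30]
  norm_num

lemma ω_ne_zero : ω ≠ 0 := Complex.exp_ne_zero _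

lemma conj_ω : (starRingEnd ℂ) ω = ω ^ 59 := by
  have h : (starRingEnd ℂ) ω * ω = 1 := by
    rw [mul_comm, Complex.mul_conj, ω, Complex.normSq_eq_norm_sq, Complex.norm_exp]
    simp
  have h60 : ω ^ 59 * ω = 1 := by rw [← pow_succ, ω_pow_60]
  exact mul_right_cancel₀ ω_ne_zero (h.trans h60.symm)

lemma ω_pow_add_inv (n : ℕ) (hn : n ≤ 60) : ω ^ n + ω ^ (60 - n) = cosAmp n := by
  have h1 : ω ^ (60 - n) = Complex.exp (-((n * Real.pi / 30 : ℝ) * Complex.I)) := by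
    rw [Complex.exp_neg, ← ω_pow]
    refine eq_inv_of_mul_eq_one_left ?_
    rw [← pow_add, Nat.sub_add_cancel hn, ω_pow_60]
  rw [h1, ω_pow, cosAmp]
  push_cast
  rw [Complex.two_cos, ← neg_mul]

/-- The equation ω³⁰ + 1 = 0 splits off x¹⁰ + 1 and, differently, x⁶ + 1. Neither vanishes at ω, and
the 60th cyclotomic polynomial is a combination of the two cofactors. -/
lemma cyclotomic_60 :
    ω ^ 16 = -ω ^ 14 + ω ^ 10 + ω ^ 8 + ω ^ 6 - ω ^ 2 - 1 := by
  have h3 : ω ^ 20 - ω ^ 10 + 1 = 0 := by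
    have h : ω ^ 10 + 1 ≠ 0 := by
      intro h
      have h1 : ω ^ 10 + ω ^ (60 - 10) = cosAmp 10 := ω_pow_add_inv 10 (by norm_num)
      have h2 : cosAmp 10 = 1 := by
        rw [cosAmp, show ((10 : ℕ) : ℝ) * Real.pi / 30 = Real.pi / 3 by push_cast; ring]
        norm_num
      -- If ω¹⁰ = -1, then ω¹⁰ + ω⁵⁰ = -1 + (-1)⁵ = -2, which is not 2cos(π/3) = 1. The same
      -- contradiction excludes ω⁶ = -1 below.
      rw [h2, eq_neg_of_add_eq_zero_left h, show 60 - 10 = 10 * 5 from rfl, pow_mul,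
        eq_neg_of_add_eq_zero_left h] at h1
      norm_num at h1
    refine (mul_eq_zero.mp ?_).resolve_left h
    linear_combination ω_pow_30
  have h5 : ω ^ 24 - ω ^ 18 + ω ^ 12 - ω ^ 6 + 1 = 0 := by
    have h : ω ^ 6 + 1 ≠ 0 := by
      intro h
      have h1 : ω ^ 6 + ω ^ (60 - 6) = cosAmp 6 := ω_pow_add_inv 6 (by norm_num)
      have h2 : 0 < cosAmp 6 := by
        rw [cosAmp, show ((6 : ℕ) : ℝ) * Real.pi / 30 = Real.pi / 5 by push_cast; ring]
        rw [Real.cos_pi_div_five]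
        positivity
      rw [eq_neg_of_add_eq_zero_left h, show 60 - 6 = 6 * 9 from rfl, pow_mul,
        eq_neg_of_add_eq_zero_left h] at h1
      norm_num at h1
      have h3 : cosAmp 6 = -2 := by
        have := h1.symm
        exact_mod_cast this
      linarith
    refine (mul_eq_zero.mp ?_).resolve_left h
    linear_combination ω_pow_30
  linear_combination (1 - ω ^ 6) * h3 + ω ^ 2 * h5

lemma ev_nil : ev [] = 0 := rfl

lemma ev_cons (a : ℤ) (p : List ℤ) : ev (a :: p) = a + ω * ev p := rfl

lemma ev_add (p q : List ℤ) : ev (add p q) = ev p + ev q := by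
  induction p, q using add.induct with
  | case1 q => simp [add, ev_nil]
  | case2 p h => cases p <;> simp [add, ev_nil]
  | case3 a p b q ih =>
    simp only [add, ev_cons, ih]
    push_cast
    ring

lemma ev_smul (a : ℤ) (p : List ℤ) : ev (smul a p) = a * ev p := by
  induction p with
  | nil => simp [smul, ev_nil]
  | cons b p ih =>
    rw [smul, List.map_cons, ev_cons, ev_cons, ← smul, ih]
    push_cast
    ring

lemma ev_mulX (p : List ℤ) : ev (mulX p) = ω * ev p := by
  unfold mulX
  split
  · next a b c d e f g h i j k l m n o p =>
    simp only [ev_cons, ev_nil]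
    push_cast
    linear_combination (-(p : ℂ)) * cyclotomic_60
  · simp [ev_cons]

lemma ev_mul (p q : List ℤ) : ev (mul p q) = ev p * ev q := by
  induction p with
  | nil => simp [mul, ev_nil]
  | cons a p ih =>
    rw [mul, List.foldr_cons, ← mul, ev_add, ev_smul, ev_mulX, ih, ev_cons]
    ring

lemma ev_shift (n : ℕ) (p : List ℤ) : ev (shift n p) = ω ^ n * ev p := by
  induction n with
  | zero => simp [shift]
  | succ n ih =>
    rw [shift, Function.iterate_succ_apply', ev_mulX, ← shift, ih, pow_succ', mul_assoc]

lemma ev_pow (n : ℕ) : ev (pow n) = ω ^ n := by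
  rw [pow, ev_shift]
  simp [ev_cons, ev_nil]

lemma ev_divX (p : List ℤ) : ev (divX p) = ω ^ 59 * ev p := by
  unfold divX
  split
  · next a b c d e f g h i j k l m n o p =>
    refine mul_left_cancel₀ ω_ne_zero ?_
    rw [← mul_assoc, ← pow_succ', ω_pow_60]
    simp only [ev_cons, ev_nil]
    push_cast
    linear_combination (-(a : ℂ)) * cyclotomic_60
  · rw [ev_mul, ev_pow]

lemma ev_conj (p : List ℤ) : ev (conj p) = (starRingEnd ℂ) (ev p) := by
  induction p with
  | nil => simp [conj, ev_nil]
  | cons a p ih =>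
    rw [conj, List.foldr_cons, ← conj, ev_add, ev_divX, ih, ev_cons, ev_cons, map_add,
      map_mul, conj_ω]
    simp [ev_nil]

/-- Only soundness is needed: zero coefficients give the value zero. Linear independence of the
powers of ω never enters. -/
lemma ev_eq_of_same {p q : List ℤ} (h : same p q = true) : ev p = ev q := by
  have h0 : ∀ l : List ℤ, l.all (· == 0) = true → ev l = 0 := by
    intro l hl
    induction l with
    | nil => rfl
    | cons a l ih =>
      simp only [List.all_cons, Bool.and_eq_true, beq_iff_eq] at hl
      rw [ev_cons, ih hl.2, hl.1]
      simp
  have := h0 _ h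
  rw [ev_add, ev_smul] at this
  push_cast at this
  linear_combination this

end Zomega

namespace Triacontagonal

/-! ### The positive roots of the polynomial -/

/-- In the variable s = 2x² - 1 the polynomial is 45/16 · (s⁴ - (2/3)s² + 1/45), a quadratic in s²
with roots z² and w². -/
lemma poly_isRoot_iff {z w : ℝ} (hz : z ^ 2 + w ^ 2 = 2 / 3) (hzw : z ^ 2 * w ^ 2 = 1 / 45)
    (x : ℝ) : poly.IsRoot x ↔
      2 * x ^ 2 - 1 = z ∨ 2 * x ^ 2 - 1 = w ∨ 2 * x ^ 2 - 1 = -w ∨ 2 * x ^ 2 - 1 = -z := by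
  have h : poly.eval x = 45 / 16 * ((2 * x ^ 2 - 1 - z) * ((2 * x ^ 2 - 1 - w) *
      ((2 * x ^ 2 - 1 - -w) * (2 * x ^ 2 - 1 - -z)))) := by
    simp only [poly, Polynomial.eval_add, Polynomial.eval_sub, Polynomial.eval_mul,
      Polynomial.eval_pow, Polynomial.eval_X, Polynomial.eval_one, Polynomial.eval_ofNat]
    linear_combination 45 / 16 * (2 * x ^ 2 - 1) ^ 2 * hz - 45 / 16 * hzw
  rw [Polynomial.IsRoot.def, h]
  have h0 : (45 / 16 : ℝ) ≠ 0 := by norm_num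
  simp only [mul_eq_zero, sub_eq_zero, h0, false_or]

lemma arePositiveRoots_iff {z w a b c d : ℝ} (hz : z ^ 2 + w ^ 2 = 2 / 3)
    (hzw : z ^ 2 * w ^ 2 = 1 / 45) (hw0 : 0 < w) (hwz : w < z) :
    ArePositiveRoots a b c d ↔ (0 < a ∧ 0 < b ∧ 0 < c ∧ 0 < d) ∧
      2 * a ^ 2 - 1 = z ∧ 2 * b ^ 2 - 1 = w ∧ 2 * c ^ 2 - 1 = -w ∧ 2 * d ^ 2 - 1 = -z := by
  have key : ∀ x y : ℝ, 0 < x → 0 < y → 2 * y ^ 2 - 1 < 2 * x ^ 2 - 1 → y < x :=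
    fun x y hx hy h => lt_of_pow_lt_pow_left₀ 2 hx.le (by linarith)
  have key' : ∀ x y : ℝ, 0 < x → 0 < y → 2 * y ^ 2 - 1 = 2 * x ^ 2 - 1 → y = x :=
    fun x y hx hy h => (pow_left_inj₀ hy.le hx.le two_ne_zero).mp (by linarith)
  constructor
  · rintro ⟨hab, hbc, hcd, hS⟩
    have hmem : ∀ x ∈ ({a, b, c, d} : Set ℝ), 0 < x ∧ poly.IsRoot x := fun x hx => by
      rwa [← hS] at hx
    obtain ⟨ha, ha'⟩ := hmem a (by simp)
    obtain ⟨hb, hb'⟩ := hmem b (by simp)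
    obtain ⟨hc, hc'⟩ := hmem c (by simp)
    obtain ⟨hd, hd'⟩ := hmem d (by simp)
    have hlt : ∀ x y : ℝ, 0 < y → y < x → 2 * y ^ 2 - 1 < 2 * x ^ 2 - 1 := fun x y hy hxy => by
      nlinarith
    have h1 := hlt _ _ hb hab
    have h2 := hlt _ _ hc hbc
    have h3 := hlt _ _ hd hcd
    rw [poly_isRoot_iff hz hzw] at ha' hb' hc' hd'
    refine ⟨⟨ha, hb, hc, hd⟩, ?_⟩
    generalize 2 * a ^ 2 - 1 = A at *
    generalize 2 * b ^ 2 - 1 = B at *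
    generalize 2 * c ^ 2 - 1 = C at *
    generalize 2 * d ^ 2 - 1 = D at *
    clear hmem key key' hS
    -- Four strictly decreasing numbers lie in {z, w, -w, -z}: bounding from the top down fixes the
    -- last one, and going back up fixes the others.
    have hA : A ≤ z := by rcases ha' with h | h | h | h <;> linarith
    have hB : B ≤ w := by rcases hb' with h | h | h | h <;> linarith
    have hC : C ≤ -w := by rcases hc' with h | h | h | h <;> linarith
    have hD : D = -z := by rcases hd' with h | h | h | h <;> linarith
    have hC' : C = -w := by rcases hc' with h | h | h | h <;> linarith
    have hB' : B = w := by rcases hb' with h | h | h | h <;> linarith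
    have hA' : A = z := by rcases ha' with h | h | h | h <;> linarith
    exact ⟨hA', hB', hC', hD⟩
  · rintro ⟨⟨ha, hb, hc, hd⟩, hA, hB, hC, hD⟩
    refine ⟨key _ _ ha hb (by linarith), key _ _ hb hc (by linarith), key _ _ hc hd (by linarith),
      ?_⟩
    ext x
    simp only [Set.mem_ofPred_eq, Set.mem_insert_iff, Set.mem_singleton_iff,
      poly_isRoot_iff hz hzw]
    constructor
    · rintro ⟨hx, h | h | h | h⟩
      · exact Or.inl (key' _ _ ha hx (by linarith))
      · exact Or.inr (Or.inl (key' _ _ hb hx (by linarith)))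
      · exact Or.inr (Or.inr (Or.inl (key' _ _ hc hx (by linarith))))
      · exact Or.inr (Or.inr (Or.inr (key' _ _ hd hx (by linarith))))
    · rintro (rfl | rfl | rfl | rfl) <;> tauto

/-- `3⁻¹ᐟ² 5⁻¹ᐟ⁴ τᵉ`. -/
noncomputable def amplitude (e : ℝ) : ℝ :=
  (3 : ℝ) ^ (-1 / 2 : ℝ) * (5 : ℝ) ^ (-1 / 4 : ℝ) * Real.goldenRatio ^ e

lemma amplitude_pos (e : ℝ) : 0 < amplitude e := by
  have := Real.goldenRatio_pos
  unfold amplitude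
  positivity

lemma amplitude_sq (e : ℝ) : amplitude e ^ 2 * (3 * √5) = Real.goldenRatio ^ (2 * e) := by
  have h3 : ((3 : ℝ) ^ (-1 / 2 : ℝ)) ^ 2 * 3 = 1 := by
    rw [← Real.rpow_natCast, ← Real.rpow_mul (by norm_num)]
    norm_num [Real.rpow_neg]
  have h5 : ((5 : ℝ) ^ (-1 / 4 : ℝ)) ^ 2 * √5 = 1 := by
    rw [← Real.rpow_natCast, ← Real.rpow_mul (by norm_num), Real.sqrt_eq_rpow,
      ← Real.rpow_add (by norm_num)]
    norm_num
  have hτ : Real.goldenRatio ^ (2 * e) = (Real.goldenRatio ^ e) ^ 2 := by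
    rw [← Real.rpow_natCast, ← Real.rpow_mul Real.goldenRatio_pos.le]
    congr 1
    push_cast
    ring
  rw [hτ, amplitude]
  linear_combination (Real.goldenRatio ^ e) ^ 2 * (((5 : ℝ) ^ (-1 / 4 : ℝ)) ^ 2 * √5 * h3 + h5)

lemma amplitude_sq_pos : amplitude (3 / 2) ^ 2 * (3 * √5) = √5 + 2 := by
  rw [amplitude_sq, show (2 * (3 / 2) : ℝ) = (3 : ℕ) by norm_num, Real.rpow_natCast,
    Real.goldenRatio]
  have := Real.sq_sqrt (show (0 : ℝ) ≤ 5 by norm_num)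
  linear_combination (√5 + 3) / 8 * this

lemma amplitude_sq_neg : amplitude (-3 / 2) ^ 2 * (3 * √5) = √5 - 2 := by
  rw [amplitude_sq, show (2 * (-3 / 2) : ℝ) = -(3 : ℕ) by norm_num,
    Real.rpow_neg Real.goldenRatio_pos.le, Real.rpow_natCast, ← inv_pow, Real.inv_goldenRatio,
    Real.goldenConj]
  have := Real.sq_sqrt (show (0 : ℝ) ≤ 5 by norm_num)
  linear_combination (√5 - 3) / 8 * this

/-- After scaling by 3√5 the two squares become τ³ = √5 + 2 and τ⁻³ = √5 - 2, with sum 2√5 and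
product 1. The bound by 1 makes all four values of x² positive. -/
lemma amplitude_relations :
    (amplitude (3 / 2) ^ 2 + amplitude (-3 / 2) ^ 2 = 2 / 3 ∧
      amplitude (3 / 2) ^ 2 * amplitude (-3 / 2) ^ 2 = 1 / 45) ∧
    amplitude (-3 / 2) < amplitude (3 / 2) ∧ amplitude (3 / 2) < 1 := by
  have h5 := Real.sq_sqrt (show (0 : ℝ) ≤ 5 by norm_num)
  have hpos : 0 < √5 := by positivity
  have h1 := amplitude_sq_pos
  have h2 := amplitude_sq_neg
  have p1 := amplitude_pos (3 / 2)
  have p2 := amplitude_pos (-3 / 2)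
  set z := amplitude (3 / 2)
  set w := amplitude (-3 / 2)
  have hsum : z ^ 2 + w ^ 2 = 2 / 3 :=
    mul_right_cancel₀ (b := 3 * √5) (by positivity) (by linear_combination h1 + h2)
  have hprod : z ^ 2 * w ^ 2 = 1 / 45 := by
    refine mul_right_cancel₀ (b := (3 * √5) * (3 * √5)) (by positivity) ?_
    linear_combination (w ^ 2 * (3 * √5)) * h1 + (√5 + 2) * h2 + 4 / 5 * h5
  refine ⟨⟨hsum, hprod⟩, ?_, ?_⟩
  · refine lt_of_pow_lt_pow_left₀ 2 p1.le (lt_of_mul_lt_mul_right ?_ (by positivity : 0 ≤ 3 * √5))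
    linarith
  · refine lt_of_pow_lt_pow_left₀ 2 zero_le_one ?_
    have : 0 < w ^ 2 := by positivity
    linarith

/-- The positive roots, in terms of the explicit values. -/
lemma arePositiveRoots_iff_amplitude (a b c d : ℝ) :
    ArePositiveRoots a b c d ↔ (0 < a ∧ 0 < b ∧ 0 < c ∧ 0 < d) ∧
      2 * a ^ 2 - 1 = amplitude (3 / 2) ∧ 2 * b ^ 2 - 1 = amplitude (-3 / 2) ∧
      2 * c ^ 2 - 1 = -amplitude (-3 / 2) ∧ 2 * d ^ 2 - 1 = -amplitude (3 / 2) :=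
  arePositiveRoots_iff amplitude_relations.1.1 amplitude_relations.1.2 (amplitude_pos _)
    amplitude_relations.2.1

lemma exists_arePositiveRoots : ∃ a b c d : ℝ, ArePositiveRoots a b c d := by
  have key : ∀ s : ℝ, |s| < 1 → ∃ x : ℝ, 0 < x ∧ 2 * x ^ 2 - 1 = s := fun s hs => by
    have : 0 < (1 + s) / 2 := by linarith [(abs_lt.mp hs).1]
    exact ⟨√((1 + s) / 2), by positivity, by rw [Real.sq_sqrt this.le]; ring⟩
  obtain ⟨-, h1, h2⟩ := amplitude_relations
  have p1 := amplitude_pos (3 / 2)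
  have p2 := amplitude_pos (-3 / 2)
  obtain ⟨a, ha, ha'⟩ := key (amplitude (3 / 2)) (abs_lt.mpr ⟨by linarith, by linarith⟩)
  obtain ⟨b, hb, hb'⟩ := key (amplitude (-3 / 2)) (abs_lt.mpr ⟨by linarith, by linarith⟩)
  obtain ⟨c, hc, hc'⟩ := key (-amplitude (-3 / 2)) (abs_lt.mpr ⟨by linarith, by linarith⟩)
  obtain ⟨d, hd, hd'⟩ := key (-amplitude (3 / 2)) (abs_lt.mpr ⟨by linarith, by linarith⟩)
  exact ⟨a, b, c, d, (arePositiveRoots_iff_amplitude a b c d).mpr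
    ⟨⟨ha, hb, hc, hd⟩, ha', hb', hc', hd'⟩⟩

end Triacontagonal

/-! ### The amplitudes as ℤ[ω]-multiples of r₅ -/

namespace Zomega

open Triacontagonal

/-- The element `cₙ` of `ℤ[ω]`. -/
def cosL (n : ℕ) : List ℤ := add (pow n) (pow (60 - n))

lemma ev_cosL (n : ℕ) (hn : n ≤ 60) : ev (cosL n) = cosAmp n := by
  rw [cosL, ev_add, ev_pow, ev_pow, ω_pow_add_inv n hn]

/-- The quotients of the amplitudes `r₁, …, r₈` by `r₅`. -/
def ratio : Fin 8 → List ℤ :=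
  let γ := add (cosL 7) (add (cosL 9) (smul (-1) (cosL 1)))
  let δ := add (cosL 8) [-1]
  ![cosL 6, mul (cosL 6) (cosL 11), mul (cosL 6) γ, mul (cosL 6) δ, [1], cosL 11, γ, δ]

/-- The inverse square of `r₅`. -/
def invSq : List ℤ :=
  mul (mul (cosL 3) (cosL 3)) (add [1] (mul (add (cosL 8) [-1]) (add (cosL 8) [-1])))

end Zomega

namespace Triacontagonal

open Zomega

lemma cosAmp_pos {n : ℕ} (hn : n < 15) : 0 < cosAmp n := by
  have hπ := Real.pi_pos
  have hn' : (n : ℝ) < 15 := by exact_mod_cast hn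
  refine mul_pos two_pos (Real.cos_pos_of_mem_Ioo ⟨?_, ?_⟩)
  · have : (0 : ℝ) ≤ n * Real.pi / 30 := by positivity
    linarith
  · nlinarith

lemma cosAmp_six : cosAmp 6 = (1 + √5) / 2 := by
  rw [cosAmp, show ((6 : ℕ) : ℝ) * Real.pi / 30 = Real.pi / 5 by push_cast; ring,
    Real.cos_pi_div_five]
  ring

lemma one_lt_cosAmp_eight : 1 < cosAmp 8 := by
  have hπ := Real.pi_pos
  have h : Real.cos (Real.pi / 3) < Real.cos ((8 : ℕ) * Real.pi / 30) :=
    Real.cos_lt_cos_of_nonneg_of_le_pi (by positivity) (by linarith) (by push_cast; linarith)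
  rw [Real.cos_pi_div_three] at h
  rw [cosAmp]
  linarith

lemma cosAmp_eight_lt : cosAmp 8 < √2 := by
  have hπ := Real.pi_pos
  have h : Real.cos ((8 : ℕ) * Real.pi / 30) < Real.cos (Real.pi / 4) :=
    Real.cos_lt_cos_of_nonneg_of_le_pi (by positivity) (by push_cast; linarith)
      (by push_cast; linarith)
  rw [Real.cos_pi_div_four] at h
  rw [cosAmp]
  linarith

/-- Put δ = c₈ - 1, u = 1 + δ², γ = c₇ + c₉ - c₁. The claims a² = 1/u, d = δa, b = c₁₁a amount to
`amplitude (3 / 2)` = (1 - δ²)/u and `amplitude (-3 / 2)` = (2c₁₁² - u)/u; the first two identities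
are their squares, with √5 = 2c₆ - 1. The next two settle signs, the fifth encodes b² + c² = 1, and
the last gives r₁/r₅ = c₆. -/
lemma cosAmp_relations :
    (1 - (cosAmp 8 - 1) ^ 2) ^ 2 * (3 * (2 * cosAmp 6 - 1)) =
        (2 * cosAmp 6 + 1) * (1 + (cosAmp 8 - 1) ^ 2) ^ 2 ∧
      (2 * cosAmp 11 ^ 2 - (1 + (cosAmp 8 - 1) ^ 2)) ^ 2 * (3 * (2 * cosAmp 6 - 1)) =
        (2 * cosAmp 6 - 3) * (1 + (cosAmp 8 - 1) ^ 2) ^ 2 ∧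
      cosAmp 11 ^ 2 = 2 - cosAmp 8 ∧
      (cosAmp 7 + cosAmp 9 - cosAmp 1) * cosAmp 7 = 1 ∧
      (cosAmp 7 + cosAmp 9 - cosAmp 1) ^ 2 + cosAmp 11 ^ 2 = 1 + (cosAmp 8 - 1) ^ 2 ∧
      cosAmp 3 = cosAmp 6 * cosAmp 9 := by
  have h1 := ev_cosL 1 (by norm_num)
  have h3 := ev_cosL 3 (by norm_num)
  have h6 := ev_cosL 6 (by norm_num)
  have h7 := ev_cosL 7 (by norm_num)
  have h8 := ev_cosL 8 (by norm_num)
  have h9 := ev_cosL 9 (by norm_num)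
  have h11 := ev_cosL 11 (by norm_num)
  have hone : ∀ m : ℤ, ev [m] = m := fun m => by simp [ev_cons, ev_nil]
  let δ := add (cosL 8) [-1]
  let u := add [1] (mul δ δ)
  let γ := add (cosL 7) (add (cosL 9) (smul (-1) (cosL 1)))
  let y := add (smul 2 (mul (cosL 11) (cosL 11))) (smul (-1) u)
  let s := smul 3 (add (smul 2 (cosL 6)) [-1])
  let x := add [1] (smul (-1) (mul δ δ))
  have e1 : ev (mul (mul x x) s) = ev (mul (add (smul 2 (cosL 6)) [1]) (mul u u)) :=
    ev_eq_of_same (by decide +kernel)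
  have e2 : ev (mul (mul y y) s) = ev (mul (add (smul 2 (cosL 6)) [-3]) (mul u u)) :=
    ev_eq_of_same (by decide +kernel)
  have e3 : ev (mul (cosL 11) (cosL 11)) = ev (add [2] (smul (-1) (cosL 8))) :=
    ev_eq_of_same (by decide +kernel)
  have e4 : ev (mul γ (cosL 7)) = ev [1] := ev_eq_of_same (by decide +kernel)
  have e5 : ev (add (mul γ γ) (mul (cosL 11) (cosL 11))) = ev u :=
    ev_eq_of_same (by decide +kernel)
  have e6 : ev (cosL 3) = ev (mul (cosL 6) (cosL 9)) := ev_eq_of_same (by decide +kernel)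
  simp only [x, y, s, u, γ, δ, ev_add, ev_mul, ev_smul, h1, h3, h6, h7, h8, h9, h11, hone]
    at e1 e2 e3 e4 e5 e6
  push_cast at e1 e2 e3 e4 e5 e6
  refine ⟨?_, ?_, ?_, ?_, ?_, ?_⟩ <;> apply Complex.ofReal_injective <;> push_cast
  · linear_combination e1
  · linear_combination e2
  · linear_combination e3
  · linear_combination e4
  · linear_combination e5
  · linear_combination e6

/-- All the positive roots are `ℤ[ω]`-multiples of the largest. -/
lemma ArePositiveRoots.ratios {a b c d : ℝ} (h : ArePositiveRoots a b c d) :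
    0 < a ∧ a ^ 2 * (1 + (cosAmp 8 - 1) ^ 2) = 1 ∧ b = cosAmp 11 * a ∧
      c = (cosAmp 7 + cosAmp 9 - cosAmp 1) * a ∧ d = (cosAmp 8 - 1) * a := by
  obtain ⟨⟨ha, hb, hc, hd⟩, hA, hB, hC, hD⟩ := (arePositiveRoots_iff_amplitude a b c d).mp h
  obtain ⟨r1, r2, r3, r4, r5, -⟩ := cosAmp_relations
  have h6 := cosAmp_six
  have h8 := one_lt_cosAmp_eight
  have h8' := cosAmp_eight_lt
  have h11 := cosAmp_pos (show 11 < 15 by norm_num)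
  have h7 := cosAmp_pos (show 7 < 15 by norm_num)
  have hγ : 0 < cosAmp 7 + cosAmp 9 - cosAmp 1 := by
    by_contra hneg
    nlinarith
  have h8sq : cosAmp 8 ^ 2 < 2 := by
    rwa [← Real.lt_sqrt (by linarith)]
  have h8lt : (cosAmp 8 - 1) ^ 2 < 1 := by linarith
  have s5 : 0 < 3 * √5 := by positivity
  have z2 := amplitude_sq_pos
  have w2 := amplitude_sq_neg
  have z0 := amplitude_pos (3 / 2)
  have w0 := amplitude_pos (-3 / 2)
  rw [show 2 * cosAmp 6 - 1 = √5 by rw [h6]; ring] at r1 r2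
  rw [show 2 * cosAmp 6 + 1 = √5 + 2 by rw [h6]; ring] at r1
  rw [show 2 * cosAmp 6 - 3 = √5 - 2 by rw [h6]; ring] at r2
  set u := 1 + (cosAmp 8 - 1) ^ 2 with hu
  have hu0 : 0 < u := by positivity
  have key : ∀ x y : ℝ, 0 < x → 0 < y → x ^ 2 = y ^ 2 → x = y :=
    fun x y hx hy hxy => (pow_left_inj₀ hx.le hy.le two_ne_zero).mp hxy
  -- The identities determine only squares. The bounds 1 < c₈ < √2 select the roots: they make 1 -
  -- δ² and 2c₁₁² - u = 2 - c₈² positive, where δ = c₈ - 1.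
  have hz : amplitude (3 / 2) * u = 1 - (cosAmp 8 - 1) ^ 2 := by
    refine key _ _ (by positivity) (by linarith) (mul_right_cancel₀ s5.ne' ?_)
    linear_combination u ^ 2 * z2 - r1
  have hw : amplitude (-3 / 2) * u = 2 * cosAmp 11 ^ 2 - u := by
    refine key _ _ (by positivity) (by linarith) (mul_right_cancel₀ s5.ne' ?_)
    linear_combination u ^ 2 * w2 - r2
  have ha2 : a ^ 2 * u = 1 := by
    linear_combination (u * hA + hz + hu) / 2
  refine ⟨ha, ha2, key _ _ hb (by positivity) ?_, key _ _ hc (by positivity) ?_,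
    key _ _ hd (mul_pos (by linarith) ha) ?_⟩ <;> refine mul_right_cancel₀ hu0.ne' ?_
  · linear_combination (u * hB + hw) / 2 - cosAmp 11 ^ 2 * ha2
  · linear_combination (u * hC - hw) / 2 - (cosAmp 7 + cosAmp 9 - cosAmp 1) ^ 2 * ha2 - r5
  · linear_combination (u * hD - hz + hu) / 2 - (cosAmp 8 - 1) ^ 2 * ha2

/-- The amplitudes are `ℤ[ω]`-multiples of `r₅`. -/
lemma ArePositiveRoots.amp_eq {a b c d : ℝ} (h : ArePositiveRoots a b c d) (k : Fin 8) :
    (amp a b c d k : ℂ) = amp a b c d 4 * ev (ratio k) := by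
  obtain ⟨-, -, hb, hc, hd⟩ := h.ratios
  have h3 : (cosAmp 3 : ℂ) ≠ 0 := by exact_mod_cast (cosAmp_pos (show 3 < 15 by norm_num)).ne'
  have h9 : (cosAmp 9 : ℂ) ≠ 0 := by exact_mod_cast (cosAmp_pos (show 9 < 15 by norm_num)).ne'
  have h6 : (cosAmp 6 : ℂ) ≠ 0 := by exact_mod_cast (cosAmp_pos (show 6 < 15 by norm_num)).ne'
  have r6 : (cosAmp 3 : ℂ) = cosAmp 6 * cosAmp 9 := by exact_mod_cast cosAmp_relations.2.2.2.2.2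
  have hone : ∀ m : ℤ, ev [m] = m := fun m => by simp [ev_cons, ev_nil]
  fin_cases k <;>
  · simp [amp, ratio, ev_mul, ev_add, ev_smul, ev_cosL, hone, hb, hc, hd, r6]
    try field_simp
    try ring

/-- This is a² + d² = 1 with d = (c₈ - 1)a and r₅ = a/c₃. -/
lemma ArePositiveRoots.amp_sq {a b c d : ℝ} (h : ArePositiveRoots a b c d) :
    (amp a b c d 4 : ℂ) ^ 2 * ev invSq = 1 := by
  obtain ⟨-, ha, -⟩ := h.ratios
  have h3 : (cosAmp 3 : ℂ) ≠ 0 := by exact_mod_cast (cosAmp_pos (show 3 < 15 by norm_num)).ne'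
  have ha' : (a : ℂ) ^ 2 * (1 + (cosAmp 8 - 1) ^ 2) = 1 := by exact_mod_cast ha
  have hone : ∀ m : ℤ, ev [m] = m := fun m => by simp [ev_cons, ev_nil]
  simp [amp, invSq, ev_mul, ev_add, ev_cosL, hone]
  field_simp
  linear_combination ha'

end Triacontagonal

/-! ### The Gram matrix and the action of the rotation -/

namespace Zomega

/-- The phase matrix divided by `r₅`. -/
def phase : Fin 8 → Fin 4 → List ℤ :=
  let p := fun i n => shift n (ratio i)
  let q := fun i n => smul (-1) (p i n)
  ![![p 0 0, p 3 0, p 5 1, p 6 1], ![p 1 29, p 2 19, q 7 24, q 4 18],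
    ![p 2 29, q 1 19, p 4 24, q 7 18], ![p 3 0, q 0 0, p 6 1, q 5 1],
    ![p 4 0, p 7 0, q 1 1, q 2 1], ![p 5 29, p 6 19, p 3 24, p 0 18],
    ![p 6 29, q 5 19, q 0 24, p 3 18], ![p 7 0, q 4 0, q 2 1, p 1 1]]

/-- The exponents of the diagonal matrix. -/
def expo : Fin 4 → ℕ := ![2, 22, 14, 26]

/-- Sum of a finite family. -/
def sum {n : ℕ} (f : Fin n → List ℤ) : List ℤ := ((List.finRange n).map f).foldr add []

lemma ev_sum {n : ℕ} (f : Fin n → List ℤ) : ev (sum f) = ∑ i, ev (f i) := by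
  have h : ∀ l : List (List ℤ), ev (l.foldr add []) = (l.map ev).sum := by
    intro l
    induction l with
    | nil => rfl
    | cons p l ih => rw [List.foldr_cons, ev_add, ih, List.map_cons, List.sum_cons]
  rw [sum, h, List.map_map, ← List.sum_ofFn, List.ofFn_eq_map]
  rfl

end Zomega

namespace Triacontagonal

open Zomega

/-- The matrix of the Coxeter element in the base `A₀, …, H₀`. -/
def coxeter : Matrix (Fin 8) (Fin 8) ℤ :=
  !![ 2,  1,  1,  1,  1,  1,  0,  0;
     -1, -1,  0,  0, -1,  0,  0,  0;
     -1,  0, -1, -1,  0,  0,  0,  0;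
      1,  0,  1,  0,  0,  0,  0,  0;
      1,  1,  0,  0,  1,  0,  1,  1;
     -1,  0,  0,  0,  0, -1,  0,  0;
      0,  0,  0,  0, -1,  0, -1, -1;
      0,  0,  0,  0,  1,  0,  1,  0]

/-- The Cartan matrix of type `E₈`, for the nodes in the order `A, …, H`. -/
def cartan : Matrix (Fin 8) (Fin 8) ℤ :=
  CartanMatrix.E₈.submatrix dynkinPos dynkinPos

/-- Adding the conjugate gives twice the real inner product, so no halves occur; the factor r₅⁻²
comes from dividing both vectors by r₅. -/
lemma phase_gram : ∀ k l : Fin 8,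
    same (sum fun j =>
        add (mul (conj (phase k j)) (phase l j)) (mul (conj (phase l j)) (phase k j)))
      (smul (cartan k l) invSq) = true := by
  decide +kernel

lemma phase_coxeter : ∀ (k : Fin 8) (j : Fin 4),
    same (shift (expo j) (phase k j)) (sum fun l => smul (coxeter k l) (phase l j)) = true := by
  decide +kernel

/-- The unitary map `diag(ω², ω²², ω¹⁴, ω²⁶)`. -/
noncomputable def rot : EuclideanSpace ℂ (Fin 4) →ₗ[ℝ] EuclideanSpace ℂ (Fin 4) where
  toFun v := WithLp.toLp 2 fun j => ω ^ expo j * v j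
  map_add' v w := by ext j; simp [mul_add]
  map_smul' t v := by ext j; simp; ring

lemma rot_apply (v : EuclideanSpace ℂ (Fin 4)) (j : Fin 4) : rot v j = ω ^ expo j * v j := rfl

lemma rot_pow_apply (n : ℕ) (v : EuclideanSpace ℂ (Fin 4)) (j : Fin 4) :
    (rot ^ n) v j = ω ^ (expo j * n) * v j := by
  induction n with
  | zero => simp
  | succ n ih =>
    rw [pow_succ', Module.End.mul_apply, rot_apply, ih]
    ring

lemma inner_rot (v w : EuclideanSpace ℂ (Fin 4)) :
    (inner ℝ (rot v) (rot w) : ℝ) = inner ℝ v w := by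
  simp only [PiLp.inner_apply, rot_apply, Complex.inner]
  refine Finset.sum_congr rfl fun j _ => ?_
  have h : (starRingEnd ℂ) (ω ^ expo j) * ω ^ expo j = 1 := by
    rw [map_pow, conj_ω, ← mul_pow, ← pow_succ, ω_pow_60, one_pow]
  rw [map_mul]
  congr 1
  linear_combination (starRingEnd ℂ) (v j) * w j * h

lemma inner_rot_pow (n : ℕ) (v w : EuclideanSpace ℂ (Fin 4)) :
    (inner ℝ ((rot ^ n) v) ((rot ^ n) w) : ℝ) = inner ℝ v w := by
  induction n with
  | zero => rfl
  | succ n ih => rw [pow_succ', Module.End.mul_apply, Module.End.mul_apply, inner_rot, ih]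

lemma rot_pow_30 : rot ^ 30 = 1 := by
  ext v j
  rw [rot_pow_apply, mul_comm (expo j), pow_mul, ω_pow_30]
  fin_cases j <;> simp [expo] <;> norm_num

section

variable {a b c d : ℝ} (h : ArePositiveRoots a b c d)
include h

lemma ArePositiveRoots.vec_apply (n : Fin 30) (k : Fin 8) (j : Fin 4) :
    vec a b c d n k j = ω ^ (expo j * n) * (amp a b c d 4 * ev (phase k j)) := by
  rw [vec]
  simp only [Matrix.mul_diagonal]
  rw [h.amp_eq 0, h.amp_eq 1, h.amp_eq 2, h.amp_eq 3, h.amp_eq 5, h.amp_eq 6, h.amp_eq 7]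
  have h4 : ev (ratio 4) = 1 := by simp [ratio, ev_cons, ev_nil]
  fin_cases k <;> fin_cases j <;>
  · simp [phaseMatrix, phase, expo, ev_smul, ev_shift, h4]
    try ring

lemma ArePositiveRoots.vec_eq_rot_pow (n : Fin 30) (k : Fin 8) :
    vec a b c d n k = (rot ^ n.val) (vec a b c d 0 k) := by
  ext j
  rw [rot_pow_apply, h.vec_apply, h.vec_apply]
  simp

lemma ArePositiveRoots.gram_zero (k l : Fin 8) :
    (inner ℝ (vec a b c d 0 k) (vec a b c d 0 l) : ℝ) = 1 / 2 * cartan k l := by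
  have key := ev_eq_of_same (phase_gram k l)
  simp only [ev_sum, ev_add, ev_mul, ev_conj, ev_smul] at key
  have hs := h.amp_sq
  have hre : ∀ z : ℂ, ((2 * z.re : ℝ) : ℂ) = z + (starRingEnd ℂ) z := fun z => by
    rw [Complex.add_conj]
  have h2 : ((2 * inner ℝ (vec a b c d 0 k) (vec a b c d 0 l) : ℝ) : ℂ) = (cartan k l : ℂ) := by
    simp only [PiLp.inner_apply, Complex.inner, Finset.mul_sum, Complex.ofReal_sum, hre,
      h.vec_apply]
    simp only [Fin.val_zero, mul_zero, pow_zero, one_mul, map_mul, Complex.conj_conj,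
      Complex.conj_ofReal]
    -- The factor 1 is written as r₅² · r₅⁻² to meet the normalisation of `phase_gram`.
    rw [← mul_one (cartan k l : ℂ), ← hs, mul_left_comm, ← key, Finset.mul_sum]
    refine Finset.sum_congr rfl fun j _ => ?_
    ring
  have h3 : 2 * inner ℝ (vec a b c d 0 k) (vec a b c d 0 l) = (cartan k l : ℝ) := by
    exact_mod_cast h2
  linarith

lemma ArePositiveRoots.gram (n : Fin 30) (k l : Fin 8) :
    (inner ℝ (vec a b c d n k) (vec a b c d n l) : ℝ) = 1 / 2 * cartan k l := by
  rw [h.vec_eq_rot_pow n k, h.vec_eq_rot_pow n l, inner_rot_pow, h.gram_zero]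

lemma ArePositiveRoots.rot_vec_zero (k : Fin 8) :
    rot (vec a b c d 0 k) = ∑ l, coxeter k l • vec a b c d 0 l := by
  ext j
  have key := ev_eq_of_same (phase_coxeter k j)
  simp only [ev_sum, ev_shift, ev_smul] at key
  simp only [rot_apply, WithLp.ofLp_sum, Finset.sum_apply, PiLp.smul_apply, h.vec_apply,
    Fin.val_zero, mul_zero, pow_zero, one_mul, zsmul_eq_mul]
  rw [mul_left_comm, key, Finset.mul_sum]
  exact Finset.sum_congr rfl fun l _ => by ring

end

/-! ### Enumeration of the standard roots along the Coxeter orbit -/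

/-- The product of a row vector with a matrix. -/
def rowMul (A : Matrix (Fin 8) (Fin 8) ℤ) (c : List ℤ) : List ℤ :=
  (List.finRange 8).map fun l => ((List.finRange 8).map fun k : Fin 8 => c.getD k 0 * A k l).sum

/-- The coordinates of the vectors `Aₙ, …, Hₙ` in the base `A₀, …, H₀`. -/
def orbit : List (List ℤ) :=
  (List.finRange 8).flatMap fun k => List.iterate (rowMul coxeter) (List.ofFn (Pi.single k 1)) 30

/-- Twice the simple roots of the standard root system of type `E₈`, in the order `A, …, H`. -/
def simpleRoots : Matrix (Fin 8) (Fin 8) ℤ :=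
  !![ 0, -2,  2,  0,  0,  0,  0,  0;
      0,  0, -2,  2,  0,  0,  0,  0;
     -2,  2,  0,  0,  0,  0,  0,  0;
      1, -1, -1, -1, -1, -1, -1,  1;
      0,  0,  0, -2,  2,  0,  0,  0;
      2,  2,  0,  0,  0,  0,  0,  0;
      0,  0,  0,  0, -2,  2,  0,  0;
      0,  0,  0,  0,  0, -2,  2,  0]

/-- The lists of length `k` with entries in `S` and sum of squares `r`. -/
def withSquareSum (S : List ℤ) : ℕ → ℤ → List (List ℤ)
  | 0, r => if r = 0 then [[]] else []
  | k + 1, r =>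
    if r < 0 then [] else S.flatMap fun a => (withSquareSum S k (r - a * a)).map (a :: ·)

/-- The search is complete: the remainder left for the tail is a sum of squares, so pruning at
negative remainders loses nothing. -/
lemma mem_withSquareSum {S l : List ℤ} (h : ∀ a ∈ l, a ∈ S) :
    l ∈ withSquareSum S l.length (l.map fun a => a * a).sum := by
  induction l with
  | nil => simp [withSquareSum]
  | cons a l ih =>
    have h0 : 0 ≤ ((a :: l).map fun a => a * a).sum :=
      List.sum_nonneg fun x hx => by
        obtain ⟨y, -, rfl⟩ := List.mem_map.mp hx
        exact mul_self_nonneg y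
    rw [List.length_cons, withSquareSum, if_neg h0.not_gt, List.mem_flatMap]
    refine ⟨a, h a (by simp), List.mem_map.mpr ⟨l, ?_, rfl⟩⟩
    rw [List.map_cons, List.sum_cons, add_sub_cancel_left]
    exact ih fun b hb => h b (by simp [hb])

/-- Twice the roots of the standard root system of type `E₈`. -/
def doubledRoots : List (List ℤ) :=
  withSquareSum [-2, 0, 2] 8 8 ++ (withSquareSum [-1, 1] 8 8).filter (fun l => l.sum % 4 = 0)

lemma nodup_orbit : orbit.Nodup := by decide +kernel

lemma length_orbit : orbit.length = 240 := by simp [orbit]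

/-- This sign coherence is what makes A₀, …, H₀ a base. -/
lemma orbit_nonneg_or_nonpos : ∀ c ∈ orbit, (∀ x ∈ c, 0 ≤ x) ∨ (∀ x ∈ c, x ≤ 0) := by
  decide +kernel

/-- Only this inclusion is enumerated. The converse follows from norms and lattice membership in
`exists_similarity`. -/
lemma doubledRoots_subset : ∀ l ∈ doubledRoots, l ∈ orbit.map (rowMul simpleRoots) := by
  decide +kernel

lemma simpleRoots_gram : simpleRoots * simpleRoots.transpose = 4 • cartan := by
  decide +kernel

lemma rowMul_ofFn (A : Matrix (Fin 8) (Fin 8) ℤ) (v : Fin 8 → ℤ) :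
    rowMul A (List.ofFn v) = List.ofFn (Matrix.vecMul v A) := by
  rw [rowMul, List.ofFn_eq_map (f := Matrix.vecMul v A)]
  refine List.map_congr_left fun l _ => ?_
  rw [Matrix.vecMul, dotProduct, ← List.sum_ofFn, List.ofFn_eq_map (f := fun i => v i * A i l)]
  exact congrArg List.sum (List.map_congr_left fun k _ => by
    rw [List.getD_eq_getElem _ _ (by simp), List.getElem_ofFn])

lemma iterate_rowMul_coxeter (n : ℕ) (k : Fin 8) :
    (rowMul coxeter)^[n] (List.ofFn (Pi.single k 1)) = List.ofFn ((coxeter ^ n) k) := by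
  induction n with
  | zero =>
    rw [Function.iterate_zero, id, pow_zero]
    congr 1
    ext l
    rw [Matrix.one_apply, Pi.single_apply]
    simp [eq_comm]
  | succ n ih =>
    rw [Function.iterate_succ_apply', ih, rowMul_ofFn, pow_succ, Matrix.mul_apply_eq_vecMul]

lemma mem_orbit {l : List ℤ} :
    l ∈ orbit ↔ ∃ (n : Fin 30) (k : Fin 8), l = List.ofFn ((coxeter ^ n.val) k) := by
  simp only [orbit, List.mem_flatMap, List.mem_iterate, List.mem_finRange, true_and,
    iterate_rowMul_coxeter]
  constructor
  · rintro ⟨k, n, hn, rfl⟩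
    exact ⟨⟨n, hn⟩, k, rfl⟩
  · rintro ⟨n, k, rfl⟩
    exact ⟨k, n, n.2, rfl⟩

/-- The simple roots of the standard root system of type `E₈`, in the order `A, …, H`. -/
noncomputable def stdRoot (k : Fin 8) : EuclideanSpace ℝ (Fin 8) :=
  WithLp.toLp 2 fun i => (simpleRoots k i : ℝ) / 2

lemma stdRoot_apply (k i : Fin 8) : stdRoot k i = (simpleRoots k i : ℝ) / 2 := rfl

lemma inner_stdRoot (k l : Fin 8) : (inner ℝ (stdRoot k) (stdRoot l) : ℝ) = cartan k l := by
  have h : ∑ i, simpleRoots k i * simpleRoots l i = 4 * cartan k l := by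
    have := congrFun (congrFun simpleRoots_gram k) l
    simpa [Matrix.mul_apply] using this
  have h' : ∑ i, (simpleRoots k i : ℝ) * simpleRoots l i = 4 * cartan k l := by exact_mod_cast h
  rw [StandardE8.inner_eq, ← mul_div_cancel_left₀ (cartan k l : ℝ) (four_ne_zero' ℝ), ← h',
    Finset.sum_div]
  refine Finset.sum_congr rfl fun i _ => ?_
  rw [stdRoot_apply, stdRoot_apply]
  ring

lemma stdRoot_mem_lattice (k : Fin 8) : stdRoot k ∈ StandardE8.lattice := by
  have h : (∀ i, simpleRoots k i = 2 * (simpleRoots k i / 2)) ∨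
      ∀ i, simpleRoots k i = 2 * (simpleRoots k i / 2) + 1 := by
    have hp : ∀ k i : Fin 8, simpleRoots k i % 2 = simpleRoots k 0 % 2 := by decide +kernel
    refine (Int.emod_two_eq_zero_or_one (simpleRoots k 0)).imp (fun h0 i => ?_) fun h0 i => ?_ <;>
    · have := hp k i
      omega
  have hs : ∑ i, simpleRoots k i = 4 * ((∑ i, simpleRoots k i) / 4) := by
    clear h
    revert k
    decide +kernel
  refine ⟨?_, (∑ i, simpleRoots k i) / 4, ?_⟩
  · refine h.imp (fun h => ⟨fun i => simpleRoots k i / 2, fun i => ?_⟩)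
      fun h => ⟨fun i => simpleRoots k i / 2, fun i => ?_⟩
    · rw [stdRoot_apply, h i]
      simp
    · rw [stdRoot_apply, h i, ← h i]
      have := h i
      have h' : (simpleRoots k i : ℝ) = 2 * (simpleRoots k i / 2 : ℤ) + 1 := by exact_mod_cast this
      rw [h']
      ring
  · simp only [stdRoot_apply, ← Finset.sum_div]
    have : (∑ i, (simpleRoots k i : ℝ)) = 4 * ((∑ i, simpleRoots k i) / 4 : ℤ) := by
      exact_mod_cast hs
    rw [this]
    ring

lemma exists_doubledRoots {x : EuclideanSpace ℝ (Fin 8)} (hx : x ∈ StandardE8.roots) :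
    ∃ m : Fin 8 → ℤ, List.ofFn m ∈ doubledRoots ∧ ∀ i, x i = (m i : ℝ) / 2 := by
  obtain ⟨⟨hm, s, hs⟩, hnorm⟩ := hx
  rw [StandardE8.inner_eq] at hnorm
  have hmem : ∀ (S : List ℤ) (m : Fin 8 → ℤ), (∀ i, m i ∈ S) → ∑ i, m i * m i = 8 →
      List.ofFn m ∈ withSquareSum S 8 8 := fun S m hS h => by
    have := mem_withSquareSum (S := S) (l := List.ofFn m) fun a ha => by
      obtain ⟨i, rfl⟩ := (List.mem_ofFn' _ _).mp ha
      exact hS i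
    rwa [List.length_ofFn, List.map_ofFn, List.sum_ofFn, Function.comp_def, h] at this
  have hle : ∀ (m : Fin 8 → ℤ) (i : Fin 8), m i * m i ≤ ∑ i, m i * m i := fun m i =>
    Finset.single_le_sum (f := fun i => m i * m i) (fun j _ => mul_self_nonneg (m j))
      (Finset.mem_univ i)
  rcases hm with ⟨m, hm⟩ | ⟨m, hm⟩
  · simp only [hm] at hnorm
    have h2 : ∑ i, m i * m i = 2 := by exact_mod_cast hnorm
    -- Integral coordinates with squares summing to 2 are two signs ±1 and zeros, so the even-sum
    -- condition is automatic and goes unused.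
    refine ⟨fun i => 2 * m i, List.mem_append_left _ (hmem _ _ (fun i => ?_) ?_), fun i => ?_⟩
    · have h := hle m i
      rw [h2] at h
      have h1 : m i ≤ 1 := by nlinarith
      have h3 : -1 ≤ m i := by nlinarith
      generalize m i = z at h1 h3
      interval_cases z <;> simp
    · rw [← show (2 * 2) * ∑ i, m i * m i = 8 by rw [h2]; rfl, Finset.mul_sum]
      exact Finset.sum_congr rfl fun i _ => by ring
    · rw [hm]
      push_cast
      ring
  · simp only [hm] at hnorm hs
    have hx2 : ∀ i, ((2 * m i + 1 : ℤ) : ℝ) = 2 * (m i + 1 / 2) := fun i => by push_cast; ring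
    have h8 : ∑ i, (2 * m i + 1) * (2 * m i + 1) = 8 := by
      have : ((∑ i, (2 * m i + 1) * (2 * m i + 1) : ℤ) : ℝ) = 8 := by
        rw [Int.cast_sum]
        simp only [Int.cast_mul, hx2, mul_mul_mul_comm, ← Finset.mul_sum, hnorm]
        norm_num
      exact_mod_cast this
    -- Eight odd squares, each at least 1, sum to 8, so each equals 1.
    have hone : ∀ i, (2 * m i + 1) * (2 * m i + 1) = 1 := fun i => by
      have hge : ∀ j ∈ Finset.univ, 1 ≤ (2 * m j + 1) * (2 * m j + 1) := fun j _ => by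
        have : 0 ≤ m j * (m j + 1) := by
          rcases le_or_gt 0 (m j) with h | h
          · positivity
          · exact mul_nonneg_of_nonpos_of_nonpos h.le (by omega)
        linarith
      exact ((Finset.sum_eq_sum_iff_of_le hge).mp (by rw [h8]; simp) i (Finset.mem_univ i)).symm
    refine ⟨fun i => 2 * m i + 1, List.mem_append_right _ (List.mem_filter.mpr
      ⟨hmem _ _ (fun i => ?_) h8, ?_⟩), fun i => ?_⟩
    · rcases mul_self_eq_one_iff.mp (hone i) with h | h <;> simp [h]
    · have h4 : ∑ i, (2 * m i + 1) = 4 * s := by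
        have : ((∑ i, (2 * m i + 1) : ℤ) : ℝ) = 4 * s := by
          rw [Int.cast_sum]
          simp only [hx2, ← Finset.mul_sum, hs]
          ring
        exact_mod_cast this
      rw [List.sum_ofFn, h4]
      simp
    · rw [hm, hx2]
      ring

lemma exists_orbit_of_mem_roots {x : EuclideanSpace ℝ (Fin 8)} (hx : x ∈ StandardE8.roots) :
    ∃ (n : Fin 30) (k : Fin 8), x = ∑ l, (coxeter ^ n.val) k l • stdRoot l := by
  obtain ⟨m, hm, hx⟩ := exists_doubledRoots hx
  obtain ⟨l, hl, hlm⟩ := List.mem_map.mp (doubledRoots_subset _ hm)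
  obtain ⟨n, k, rfl⟩ := mem_orbit.mp hl
  rw [rowMul_ofFn] at hlm
  refine ⟨n, k, ?_⟩
  ext i
  rw [hx, ← List.ofFn_injective hlm, Matrix.vecMul, dotProduct]
  simp [stdRoot_apply, Finset.sum_div, mul_div_assoc]

end Triacontagonal

/-! ### The similarity with the standard root system -/

namespace EuclideanRoots

variable {E F : Type*} [NormedAddCommGroup E] [InnerProductSpace ℝ E]
  [NormedAddCommGroup F] [InnerProductSpace ℝ F]

lemma map_refl (f : E ≃ₗ[ℝ] F) {r : ℝ} (hr : r ≠ 0)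
    (hf : ∀ x y, (inner ℝ (f x) (f y) : ℝ) = r * inner ℝ x y) (x y : E) :
    f (refl x y) = refl (f x) (f y) := by
  rw [refl, refl, map_sub, map_smul, hf, hf, mul_left_comm, mul_div_mul_left _ _ hr]

end EuclideanRoots

namespace Triacontagonal

/-- The `E₈` Cartan matrix is unimodular, so its inverse is integral. -/
lemma cartan_mul_inverse : cartan *
    !![30, 24, 20, 10, 18, 15, 12,  6;
       24, 20, 16,  8, 15, 12, 10,  5;
       20, 16, 14,  7, 12, 10,  8,  4;
       10,  8,  7,  4,  6,  5,  4,  2;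
       18, 15, 12,  6, 12,  9,  8,  4;
       15, 12, 10,  5,  9,  8,  6,  3;
       12, 10,  8,  4,  8,  6,  6,  3;
        6,  5,  4,  2,  4,  3,  3,  2] = 1 := by
  decide +kernel

lemma cartan_self (k : Fin 8) : cartan k k = 2 := by
  revert k
  decide +kernel

/-- Pairing a relation with each vector puts its coefficients in the left kernel of the invertible
Cartan matrix. -/
lemma linearIndependent_of_inner_eq {E : Type*} [NormedAddCommGroup E] [InnerProductSpace ℝ E]
    {v : Fin 8 → E} {r : ℝ} (hr : r ≠ 0)
    (h : ∀ k l, (inner ℝ (v k) (v l) : ℝ) = r * cartan k l) : LinearIndependent ℝ v := by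
  rw [Fintype.linearIndependent_iff]
  intro g hg
  have h0 : Matrix.vecMul g (cartan.map (Int.castRingHom ℝ)) = 0 := by
    ext l
    have := congrArg (fun x => (inner ℝ x (v l) : ℝ)) hg
    simp only [sum_inner, real_inner_smul_left, h, inner_zero_left, mul_left_comm _ r,
      ← Finset.mul_sum, mul_eq_zero, hr, false_or] at this
    exact this
  have h1 := congrArg (fun A => A.map (Int.castRingHom ℝ)) cartan_mul_inverse
  rw [Matrix.map_mul, Matrix.map_one _ (map_zero _) (map_one _)] at h1
  intro k
  rw [← Matrix.vecMul_one g, ← h1, ← Matrix.vecMul_vecMul, h0, Matrix.zero_vecMul, Pi.zero_apply]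

lemma finrank_complex : Module.finrank ℝ (EuclideanSpace ℂ (Fin 4)) = 8 := by
  rw [finrank_real_of_complex, finrank_euclideanSpace_fin]

section

variable {a b c d : ℝ} (h : ArePositiveRoots a b c d)
include h

lemma ArePositiveRoots.vec_eq_sum (n : Fin 30) (k : Fin 8) :
    vec a b c d n k = ∑ l, (coxeter ^ n.val) k l • vec a b c d 0 l := by
  rw [h.vec_eq_rot_pow]
  generalize n.val = n
  induction n with
  | zero => simp [Matrix.one_apply]
  | succ n ih =>
    rw [pow_succ', Module.End.mul_apply, ih, map_sum]
    simp only [map_zsmul, h.rot_vec_zero, Finset.smul_sum, smul_smul]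
    rw [Finset.sum_comm]
    refine Finset.sum_congr rfl fun l _ => ?_
    rw [← Finset.sum_smul, pow_succ, Matrix.mul_apply]

/-- The similarity that takes the standard root system of type `E₈` to the vectors
`Aₙ, …, Hₙ`. -/
lemma ArePositiveRoots.exists_similarity :
    ∃ f : EuclideanSpace ℝ (Fin 8) ≃ₗ[ℝ] EuclideanSpace ℂ (Fin 4),
      (∀ x y, (inner ℝ (f x) (f y) : ℝ) = 1 / 2 * inner ℝ x y) ∧
      ∀ x, x ∈ StandardE8.roots ↔ f x ∈ vecs a b c d := by
  have hs : LinearIndependent ℝ stdRoot :=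
    linearIndependent_of_inner_eq one_ne_zero fun k l => by rw [inner_stdRoot, one_mul]
  have hv : LinearIndependent ℝ (vec a b c d 0) :=
    linearIndependent_of_inner_eq (by norm_num) h.gram_zero
  let bs := basisOfLinearIndependentOfCardEqFinrank hs (by simp)
  let bv := basisOfLinearIndependentOfCardEqFinrank hv (by simp [finrank_complex])
  let f := bs.equiv bv (Equiv.refl _)
  have hf : ∀ k, f (stdRoot k) = vec a b c d 0 k := fun k => by
    have := bs.equiv_apply k bv (Equiv.refl _)
    simpa [bs, bv] using this
  have hin : ∀ x y, (inner ℝ (f x) (f y) : ℝ) = 1 / 2 * inner ℝ x y := by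
    have : (innerₗ (EuclideanSpace ℂ (Fin 4))).compl₁₂ f.toLinearMap f.toLinearMap =
        (1 / 2 : ℝ) • innerₗ (EuclideanSpace ℝ (Fin 8)) := by
      refine bs.ext fun k => bs.ext fun l => ?_
      simp [bs, hf, h.gram_zero, inner_stdRoot]
    intro x y
    exact LinearMap.congr_fun (LinearMap.congr_fun this x) y
  have hsum : ∀ (n : Fin 30) (k : Fin 8),
      f (∑ l, (coxeter ^ n.val) k l • stdRoot l) = vec a b c d n k := fun n k => by
    rw [h.vec_eq_sum, map_sum]
    simp only [map_zsmul, hf]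
  refine ⟨f, hin, fun x => ⟨fun hx => ?_, ?_⟩⟩
  · obtain ⟨n, k, rfl⟩ := exists_orbit_of_mem_roots hx
    exact ⟨n, k, hsum n k⟩
  · rintro ⟨n, k, hx⟩
    -- The image has norm 1, so x has squared length 2; x is also an integral combination of simple
    -- roots, hence a lattice vector.
    have hnorm := hin x x
    rw [hx, h.gram, cartan_self] at hnorm
    rw [← hsum, f.injective.eq_iff] at hx
    refine ⟨?_, by push_cast at hnorm; linarith⟩
    rw [hx]
    exact sum_mem fun l _ => zsmul_mem (stdRoot_mem_lattice l) _

lemma ArePositiveRoots.inner_self {v : EuclideanSpace ℂ (Fin 4)} (hv : v ∈ vecs a b c d) :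
    (inner ℝ v v : ℝ) = 1 := by
  obtain ⟨n, k, rfl⟩ := hv
  rw [h.gram, cartan_self]
  norm_num

lemma ArePositiveRoots.norm_eq_one {v : EuclideanSpace ℂ (Fin 4)} (hv : v ∈ vecs a b c d) :
    ‖v‖ = 1 := by
  have := h.inner_self hv
  rwa [real_inner_self_eq_norm_sq, pow_eq_one_iff_of_nonneg (norm_nonneg v) two_ne_zero] at this

lemma ArePositiveRoots.coroot_eq {v : EuclideanSpace ℂ (Fin 4)} (hv : v ∈ vecs a b c d) :
    EuclideanRoots.coroot v = (2 : ℝ) • v := by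
  rw [EuclideanRoots.coroot, h.inner_self hv, div_one]

lemma ArePositiveRoots.linearIndependent (n : Fin 30) : LinearIndependent ℝ (vec a b c d n) :=
  linearIndependent_of_inner_eq (by norm_num) (h.gram n)

lemma ArePositiveRoots.linearIndependent_two_smul (n : Fin 30) :
    LinearIndependent ℝ fun k => (2 : ℝ) • vec a b c d n k :=
  linearIndependent_of_inner_eq two_ne_zero fun k l => by
    rw [real_inner_smul_left, real_inner_smul_right, h.gram]
    ring

/-- The 240 coordinate lists are distinct, and independence of A₀, …, H₀ keeps the vectors distinct.
-/
lemma ArePositiveRoots.ncard_vecs : (vecs a b c d).ncard = 240 := by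
  let g : List ℤ → EuclideanSpace ℂ (Fin 4) := fun l => ∑ i : Fin 8, l.getD i 0 • vec a b c d 0 i
  have hg : ∀ m : Fin 8 → ℤ, g (List.ofFn m) = ∑ i, m i • vec a b c d 0 i := fun m => by
    refine Finset.sum_congr rfl fun i _ => ?_
    rw [List.getD_eq_getElem _ _ (by simp), List.getElem_ofFn]
  have himage : vecs a b c d = g '' (orbit.toFinset : Set (List ℤ)) := by
    ext v
    simp only [vecs, Set.mem_ofPred_eq, Set.mem_image, Finset.mem_coe, List.mem_toFinset,
      mem_orbit]
    constructor
    · rintro ⟨n, k, rfl⟩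
      exact ⟨_, ⟨n, k, rfl⟩, by rw [hg, h.vec_eq_sum]⟩
    · rintro ⟨_, ⟨n, k, rfl⟩, rfl⟩
      exact ⟨n, k, by rw [hg, h.vec_eq_sum]⟩
  rw [himage, Set.InjOn.ncard_image, Set.ncard_coe_finset, List.toFinset_card_of_nodup nodup_orbit,
    length_orbit]
  intro l hl l' hl' hll
  obtain ⟨n, k, rfl⟩ := mem_orbit.mp (List.mem_toFinset.mp hl)
  obtain ⟨n', k', rfl⟩ := mem_orbit.mp (List.mem_toFinset.mp hl')
  rw [hg, hg] at hll
  congr 1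
  funext i
  simp only [← Int.cast_smul_eq_zsmul ℝ] at hll
  exact_mod_cast Fintype.linearIndependent_iffₛ.mp (h.linearIndependent 0) _ _ hll i

/-- Each of the vectors is a sum of the vectors `Aₙ, …, Hₙ` or of their negatives. -/
lemma ArePositiveRoots.mem_closure (n : Fin 30) {v : EuclideanSpace ℂ (Fin 4)}
    (hv : v ∈ vecs a b c d) :
    v ∈ AddSubmonoid.closure (Set.range (vec a b c d n)) ∨
      -v ∈ AddSubmonoid.closure (Set.range (vec a b c d n)) := by
  obtain ⟨m, k, rfl⟩ := hv
  have hv : vec a b c d m k = ∑ l, (coxeter ^ (m - n).val) k l • vec a b c d n l := by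
    -- The difference m - n is taken modulo 30; a possible excess of 30 disappears because `rot ^ 30
    -- = 1`.
    have h1 : vec a b c d m k = (rot ^ n.val) (vec a b c d (m - n) k) := by
      rw [h.vec_eq_rot_pow m, h.vec_eq_rot_pow (m - n), ← Module.End.mul_apply, ← pow_add]
      have h2 : (n.val + (m - n).val) % 30 = m.val := by
        rw [← Fin.val_add]
        simp
      rw [← h2, ← Nat.div_add_mod (n.val + (m - n).val) 30, pow_add, pow_mul, rot_pow_30]
      simp
    rw [h1, h.vec_eq_sum, map_sum]
    simp only [map_zsmul, ← h.vec_eq_rot_pow]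
  have hsum : ∀ p : Fin 8 → ℤ, (∀ l, 0 ≤ p l) →
      ∑ l, p l • vec a b c d n l ∈ AddSubmonoid.closure (Set.range (vec a b c d n)) := by
    intro p hp
    refine sum_mem fun l _ => ?_
    obtain ⟨q, hq⟩ := Int.eq_ofNat_of_zero_le (hp l)
    rw [hq, natCast_zsmul]
    exact nsmul_mem (AddSubmonoid.subset_closure (Set.mem_range_self l)) q
  have hmem : ∀ (p : Fin 8 → ℤ) (l : Fin 8), p l ∈ List.ofFn p := fun p l =>
    (List.mem_ofFn' p (p l)).mpr ⟨l, rfl⟩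
  rw [hv]
  refine (orbit_nonneg_or_nonpos _ (mem_orbit.mpr ⟨m - n, k, rfl⟩)).imp (fun hp => ?_) fun hp => ?_
  · exact hsum _ fun l => hp _ (hmem _ l)
  · rw [← Finset.sum_neg_distrib]
    simp only [← neg_smul]
    exact hsum _ fun l => neg_nonneg.mpr (hp _ (hmem _ l))

end

/-! ### The root pairing and its bases -/

section

variable {a b c d : ℝ} (h : ArePositiveRoots a b c d)
include h

lemma ArePositiveRoots.zero_notMem : (0 : EuclideanSpace ℂ (Fin 4)) ∉ vecs a b c d := by
  intro h0
  have := h.inner_self h0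
  simp at this

lemma ArePositiveRoots.refl_mem : ∀ x ∈ vecs a b c d, ∀ y ∈ vecs a b c d,
    EuclideanRoots.refl x y ∈ vecs a b c d := by
  obtain ⟨f, hf, hroots⟩ := h.exists_similarity
  intro x hx y hy
  obtain ⟨x, rfl⟩ := f.surjective x
  obtain ⟨y, rfl⟩ := f.surjective y
  rw [← EuclideanRoots.map_refl f (one_div_ne_zero two_ne_zero) hf]
  rw [← hroots] at hx hy
  exact (hroots _).mp (StandardE8.refl_mem_roots x hx y hy)

variable (h0 : 0 ∉ vecs a b c d)
  (hrefl : ∀ x ∈ vecs a b c d, ∀ y ∈ vecs a b c d, EuclideanRoots.refl x y ∈ vecs a b c d)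

lemma ArePositiveRoots.rootPairing_pairing (x y : vecs a b c d) :
    (rootPairing a b c d h0 hrefl).pairing x y = 2 * inner ℝ (x : EuclideanSpace ℂ (Fin 4)) y := by
  change (inner ℝ (x : EuclideanSpace ℂ (Fin 4)) (EuclideanRoots.coroot y) : ℝ) = _
  rw [h.coroot_eq y.2, real_inner_smul_right]

lemma ArePositiveRoots.isRootSystem : (rootPairing a b c d h0 hrefl).IsRootSystem where
  span_root_eq_top := by
    rw [eq_top_iff, ← (h.linearIndependent 0).span_eq_top_of_card_eq_finrank
      (by simp [finrank_complex])]
    refine Submodule.span_mono ?_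
    rintro _ ⟨k, rfl⟩
    exact ⟨⟨_, 0, k, rfl⟩, rfl⟩
  span_coroot_eq_top := by
    rw [eq_top_iff, ← (h.linearIndependent_two_smul 0).span_eq_top_of_card_eq_finrank
      (by simp [finrank_complex])]
    refine Submodule.span_mono ?_
    rintro _ ⟨k, rfl⟩
    exact ⟨⟨_, 0, k, rfl⟩, h.coroot_eq ⟨0, k, rfl⟩⟩

lemma ArePositiveRoots.isReduced : (rootPairing a b c d h0 hrefl).IsReduced where
  eq_or_eq_neg := by
    rintro ⟨x, hx⟩ ⟨y, hy⟩ hxy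
    change ¬LinearIndependent ℝ ![x, y] at hxy
    change x = y ∨ x = -y
    rw [LinearIndependent.pair_iff' (ne_of_mem_of_not_mem hx h0)] at hxy
    push Not at hxy
    obtain ⟨t, rfl⟩ := hxy
    have ht := h.norm_eq_one hy
    rw [norm_smul, h.norm_eq_one hx, mul_one, Real.norm_eq_abs] at ht
    rcases eq_or_eq_neg_of_abs_eq ht with rfl | rfl <;> simp

/-- The coroot factor 2 cancels the scaling 1/2 of the similarity, leaving an inner product of two
`E₈` lattice vectors. -/
lemma ArePositiveRoots.isCrystallographic :
    (rootPairing a b c d h0 hrefl).IsCrystallographic where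
  exists_value x y := by
    obtain ⟨f, hf, hroots⟩ := h.exists_similarity
    obtain ⟨x', hx⟩ := f.surjective x
    obtain ⟨y', hy⟩ := f.surjective y
    obtain ⟨z, hz⟩ := StandardE8.inner_int ((hroots x').mpr (hx ▸ x.2)).1
      ((hroots y').mpr (hy ▸ y.2)).1
    refine ⟨z, ?_⟩
    rw [h.rootPairing_pairing, ← hx, ← hy, hf, hz]
    simp

lemma ArePositiveRoots.nonempty_equiv :
    Nonempty ((rootPairing a b c d h0 hrefl).Equiv StandardE8.rootPairing) := by
  obtain ⟨f, hf, hroots⟩ := h.exists_similarity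
  have hcoroot : ∀ x ∈ StandardE8.roots, EuclideanRoots.coroot x = x := fun x hx => by
    rw [EuclideanRoots.coroot, hx.2, div_self two_ne_zero, one_smul]
  let e : vecs a b c d ≃ StandardE8.roots :=
    { toFun := fun v => ⟨f.symm v, (hroots _).mpr (by simp)⟩
      invFun := fun x => ⟨f x, (hroots _).mp x.2⟩
      left_inv := fun v => by simp
      right_inv := fun x => by simp }
  refine ⟨{
    weightMap := f.symm.toLinearMap
    -- A standard root is its own coroot, while the unit vector f x has coroot 2 f x.
    coweightMap := (2 : ℝ) • f.toLinearMap
    indexEquiv := e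
    weight_coweight_transpose := ?_
    root_weightMap := rfl
    coroot_coweightMap := ?_
    bijective_weightMap := f.symm.bijective
    bijective_coweightMap := ?_ }⟩
  · refine LinearMap.ext fun x => LinearMap.ext fun v => ?_
    change (inner ℝ (f.symm v) x : ℝ) = inner ℝ v ((2 : ℝ) • f x)
    have := hf (f.symm v) x
    rw [f.apply_symm_apply] at this
    rw [real_inner_smul_right, this]
    ring
  · funext x
    change (2 : ℝ) • f (EuclideanRoots.coroot (x : EuclideanSpace ℝ (Fin 8))) =
      EuclideanRoots.coroot (f x)
    rw [hcoroot x x.2, h.coroot_eq ((hroots _).mp x.2)]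
  · exact (f.trans (LinearEquiv.smulOfNeZero ℝ _ (2 : ℝ) two_ne_zero)).bijective

lemma ArePositiveRoots.exists_base [(rootPairing a b c d h0 hrefl).IsCrystallographic]
    (n : Fin 30) :
    ∃ (B : (rootPairing a b c d h0 hrefl).Base) (e : Fin 8 ≃ B.support),
      (∀ k, (rootPairing a b c d h0 hrefl).root (e k) = vec a b c d n k) ∧
      ∀ k l, B.cartanMatrix (e k) (e l) = CartanMatrix.E₈ (dynkinPos k) (dynkinPos l) := by
  let g : Fin 8 → vecs a b c d := fun k => ⟨vec a b c d n k, n, k, rfl⟩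
  have hg : Function.Injective g := fun k l hkl =>
    (h.linearIndependent n).injective (Subtype.ext_iff.mp hkl)
  let s : Finset (vecs a b c d) := Finset.univ.map ⟨g, hg⟩
  have hs : (s : Set (vecs a b c d)) = Set.range g := by simp [s]
  have hroot : (rootPairing a b c d h0 hrefl).root ∘ g = vec a b c d n := rfl
  have hcoroot : (rootPairing a b c d h0 hrefl).coroot ∘ g = fun k => (2 : ℝ) • vec a b c d n k :=
    funext fun k => h.coroot_eq (g k).2
  let B : (rootPairing a b c d h0 hrefl).Base :=
    { support := s
      linearIndepOn_root := by
        rw [hs, linearIndepOn_range_iff hg, hroot]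
        exact h.linearIndependent n
      linearIndepOn_coroot := by
        rw [hs, linearIndepOn_range_iff hg, hcoroot]
        exact h.linearIndependent_two_smul n
      root_mem_or_neg_mem := fun x => by
        rw [hs, ← Set.range_comp, hroot]
        exact h.mem_closure n x.2
      coroot_mem_or_neg_mem := fun x => by
        rw [hs, ← Set.range_comp, hcoroot]
        have hx : (rootPairing a b c d h0 hrefl).coroot x =
            (2 : ℝ) • (x : EuclideanSpace ℂ (Fin 4)) := h.coroot_eq x.2
        have himage : ∀ v ∈ AddSubmonoid.closure (Set.range (vec a b c d n)),
            (2 : ℝ) • v ∈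
              AddSubmonoid.closure (Set.range fun k => (2 : ℝ) • vec a b c d n k) := by
          intro v hv
          have := AddSubmonoid.mem_map_of_mem
            (DistribSMul.toAddMonoidHom (EuclideanSpace ℂ (Fin 4)) (2 : ℝ)) hv
          rwa [AddMonoidHom.map_mclosure, ← Set.range_comp] at this
        rw [hx, ← smul_neg]
        exact (h.mem_closure n x.2).imp (himage _) (himage _) }
  have hmem : ∀ k, g k ∈ B.support := fun k => by simp [B, s]
  let e : Fin 8 ≃ B.support := Equiv.ofBijective (fun k => ⟨g k, hmem k⟩)
    ⟨fun k l hkl => hg (Subtype.ext_iff.mp hkl), fun ⟨x, hx⟩ => by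
      obtain ⟨k, -, rfl⟩ := Finset.mem_map.mp hx
      exact ⟨k, rfl⟩⟩
  refine ⟨B, e, fun k => rfl, fun k l => ?_⟩
  have h1 : (B.cartanMatrix (e k) (e l) : ℝ) = 2 * inner ℝ (vec a b c d n k) (vec a b c d n l) :=
    (B.algebraMap_cartanMatrixIn_apply ℤ (e k) (e l)).trans
      (h.rootPairing_pairing h0 hrefl (g k) (g l))
  rw [h.gram, ← mul_assoc, mul_one_div_cancel two_ne_zero, one_mul] at h1
  exact_mod_cast h1

end

end Triacontagonal

theorem mainTheorem1 :
    (∃ a b c d : ℝ, Triacontagonal.ArePositiveRoots a b c d) ∧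
    ∀ a b c d : ℝ, Triacontagonal.ArePositiveRoots a b c d →
      -- the explicit values of `a, b, c, d`
      (2 * a ^ 2 = 1 + (3 : ℝ) ^ (-1 / 2 : ℝ) * (5 : ℝ) ^ (-1 / 4 : ℝ)
          * Real.goldenRatio ^ (3 / 2 : ℝ) ∧
        2 * b ^ 2 = 1 + (3 : ℝ) ^ (-1 / 2 : ℝ) * (5 : ℝ) ^ (-1 / 4 : ℝ)
          * Real.goldenRatio ^ (-3 / 2 : ℝ) ∧
        2 * c ^ 2 = 1 - (3 : ℝ) ^ (-1 / 2 : ℝ) * (5 : ℝ) ^ (-1 / 4 : ℝ)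
          * Real.goldenRatio ^ (-3 / 2 : ℝ) ∧
        2 * d ^ 2 = 1 - (3 : ℝ) ^ (-1 / 2 : ℝ) * (5 : ℝ) ^ (-1 / 4 : ℝ)
          * Real.goldenRatio ^ (3 / 2 : ℝ)) ∧
      -- there are 240 vectors, all of norm 1
      (Triacontagonal.vecs a b c d).ncard = 240 ∧
      (∀ v ∈ Triacontagonal.vecs a b c d, ‖v‖ = 1) ∧
      -- they form a root system, isomorphic to the standard root system of type `E₈`
      ∃ (h0 : (0 : EuclideanSpace ℂ (Fin 4)) ∉ Triacontagonal.vecs a b c d)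
        (hrefl : ∀ x ∈ Triacontagonal.vecs a b c d, ∀ y ∈ Triacontagonal.vecs a b c d,
          EuclideanRoots.refl x y ∈ Triacontagonal.vecs a b c d),
        (Triacontagonal.rootPairing a b c d h0 hrefl).IsRootSystem ∧
        (Triacontagonal.rootPairing a b c d h0 hrefl).IsReduced ∧
        Nonempty ((Triacontagonal.rootPairing a b c d h0 hrefl).Equiv StandardE8.rootPairing) ∧
        ∃ _ : (Triacontagonal.rootPairing a b c d h0 hrefl).IsCrystallographic,
          -- for each `n`, the vectors `Aₙ, …, Hₙ` are a base with the `E₈` Dynkin diagram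
          ∀ n : Fin 30, ∃ (B : (Triacontagonal.rootPairing a b c d h0 hrefl).Base)
              (e : Fin 8 ≃ B.support),
            (∀ k, (Triacontagonal.rootPairing a b c d h0 hrefl).root (e k) = Triacontagonal.vec a b c d n k) ∧
            ∀ k l, B.cartanMatrix (e k) (e l) =
              CartanMatrix.E₈ (Triacontagonal.dynkinPos k) (Triacontagonal.dynkinPos l) := by
  refine ⟨Triacontagonal.exists_arePositiveRoots, fun a b c d h => ?_⟩
  obtain ⟨-, hA, hB, hC, hD⟩ := (Triacontagonal.arePositiveRoots_iff_amplitude a b c d).mp h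
  simp only [Triacontagonal.amplitude] at hA hB hC hD
  have := h.isCrystallographic h.zero_notMem h.refl_mem
  exact ⟨⟨by linarith, by linarith, by linarith, by linarith⟩, h.ncard_vecs,
    fun v hv => h.norm_eq_one hv, h.zero_notMem, h.refl_mem, h.isRootSystem _ _, h.isReduced _ _,
    h.nonempty_equiv _ _, this, h.exists_base _ _⟩
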